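/- A configuration of $t$ pebbles on a finite graph $G$ is a function $C:V(G)\to\mathbb{Z}_{\ge 0}$ with $\sum_v C(v)=t$. A pebbling step removes two pebbles from a vertex and places one pebble on an adjacent vertex. $C$ is solvable if for every vertex $r$ some finite (possibly empty) sequence of pebbling steps leads to a configuration with at least one pebble on $r$. Let $P_G(t)$ be the probability that a configuration chosen uniformly at random among all configurations of $t$ pebbles on $G$ is solvable. For a sequence of graphs $\mathcal{G}=(G_1,G_2,\dots)$, the pebbling threshold $\tau_{\mathcal{G}}$ is the set of all functions $f=f(n)$ such that, for integer sequences $t=t(n)\ge 0$, $P_{G_n}(t(n))\to 1$ whenever $f(n)=o(t(n))$, and $P_{G_n}(t(n))\to 0$ whenever $t(n)=o(f(n))$, as $n\to\infty$. Theorem 1. Let $\mathcal{K}=(K_n)_{n\ge1}$ be the sequence of cliques and let $\mathcal{K}^2=(K_n\Box K_n)_{n\ge 1}$ be the sequence of their cartesian squares, with $N=N(n)=n^2$ vertices. Then $$\tau_{\mathcal{K}^2}=\Theta(\sqrt N);$$ that is, a function $f$ belongs to $\tau_{\mathcal{K}^2}$ if and only if $f\in\Theta(\sqrt{N})=\Theta(n)$.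 In particular, almost every configuration of $\varpi n$ pebbles with $\varpi=\varpi(n)\to\infty$ is solvable, and almost no configuration of $o(n)$ pebbles is. Moreover, the threshold version of Graham's product conjecture holds in this case: if $f,g\in\tau_{\mathcal{K}}$ and $h\in\tau_{\mathcal{K}^2}$, then $h(n)\in O(f(n)g(n))$. -/

import Mathlib

open Filter Asymptotics Topology

namespace Pebbling

/-- `D` arises from the configuration `C` by one pebbling step along an edge `uv` of `G`:
two pebbles are removed from `u` and one pebble is placed on the neighbour `v`. -/
def Step {V : Type*} [DecidableEq V] (G : SimpleGraph V) (C D : V → ℕ) : Prop :=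
  ∃ u v, G.Adj u v ∧ 2 ≤ C u ∧
    D = Function.update (Function.update C u (C u - 2)) v (C v + 1)

/-- The configuration `C` is `r`-solvable: finitely many (possibly zero) pebbling steps
lead to a configuration with at least one pebble on `r`. -/
def RootSolvable {V : Type*} [DecidableEq V] (G : SimpleGraph V) (C : V → ℕ) (r : V) : Prop :=
  ∃ D : V → ℕ, Relation.ReflTransGen (Step G) C D ∧ 1 ≤ D r

/-- The configuration `C` is solvable: it is `r`-solvable for every root `r`. -/
def Solvable {V : Type*} [DecidableEq V] (G : SimpleGraph V) (C : V → ℕ) : Prop :=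
  ∀ r : V, RootSolvable G C r

/-- The configurations of `t` (unlabelled) pebbles on `V`: all `C : V → ℕ` with `∑ v, C v = t`. -/
def configs (V : Type*) [Fintype V] [DecidableEq V] (t : ℕ) : Finset (V → ℕ) :=
  Finset.piAntidiag Finset.univ t

open Classical in
/-- The probability that a configuration chosen uniformly at random among all configurations
of `t` pebbles on the vertices of `G` is solvable. -/
noncomputable def solvableProb {V : Type*} [Fintype V] [DecidableEq V] (G : SimpleGraph V)
    (t : ℕ) : ℝ :=
  (((configs V t).filter fun C => Solvable G C).card : ℝ) / ((configs V t).card : ℝ)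

/-- The pebbling threshold of a sequence of graphs: the set of all functions `f` such that the
probability of solvability tends to `1` whenever `t ≫ f` and to `0` whenever `t ≪ f`.
Here `t n` is the (integral) number of pebbles placed on the `n`-th graph. -/
def threshold {V : ℕ → Type*} [∀ n, Fintype (V n)] [∀ n, DecidableEq (V n)]
    (G : ∀ n, SimpleGraph (V n)) : Set (ℕ → ℝ) :=
  {f | (∀ t : ℕ → ℕ, f =o[atTop] (fun n => (t n : ℝ)) →
          Tendsto (fun n => solvableProb (G n) (t n)) atTop (𝓝 1)) ∧
       (∀ t : ℕ → ℕ, (fun n => (t n : ℝ)) =o[atTop] f →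
          Tendsto (fun n => solvableProb (G n) (t n)) atTop (𝓝 0))}

/-- The complete graph `K_n`. -/
def clique (n : ℕ) : SimpleGraph (Fin n) := ⊤

/-- The cartesian product `K_n □ K_n`. -/
def cliqueSquare (n : ℕ) : SimpleGraph (Fin n × Fin n) := (clique n).boxProd (clique n)

end Pebbling

/-! Lower bound, valid on any graphs: if no vertex holds two pebbles, no step is possible, so an
empty vertex is unreachable. By a birthday bound, `t` pebbles on `N` vertices put two on one vertex
with probability at most `t ^ 2 / N` (`prob_exists_two_le`, `solvableProb_le`), so `o(√N)` pebbles
almost never suffice.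

Upper bound on the square: two vertices with two pebbles each, joined by an occupied path, solve
every root (`solvable_of_linked_two`). They are found in two stages. With `6n` pebbles, a union
bound over the `4 ^ n` pairs (set of rows, set of columns) shows that every large cut is occupied,
which forces a connected occupied set of at least `n / 3` cells (`CutsOccupied.exists_linkedSet`).
Then `B n` further pebbles double one cell of it and another `B n` a second one, up to error `2
exp(-B / 12)`. Adding pebbles one at a time is exact by Pólya's urn: a uniform configuration stays
uniform if `v` is chosen with weight `C v + 1` (`sum_configs_succ`, `prob_not_add_le`).

Subsequence arguments turn these bounds into the description of the threshold by `Θ`. The product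
statement follows since thresholds of cliques are at least of order `√n`, and `√n * √n = n`. -/

namespace Pebbling

/-! ### Uniform random configurations, Pólya's urn and sprinkling -/

section Average

variable {V : Type*} [Fintype V] [DecidableEq V]

lemma mem_configs {t : ℕ} {C : V → ℕ} : C ∈ configs V t ↔ ∑ v, C v = t := by
  simp [configs]

lemma configs_nonempty [Nonempty V] (t : ℕ) : (configs V t).Nonempty :=
  ⟨Pi.single (Classical.arbitrary V) t, by simp [mem_configs]⟩

/-- The mean of `F` over all configurations of `t` pebbles. -/
noncomputable def average (t : ℕ) (F : (V → ℕ) → ℝ) : ℝ :=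
  (∑ C ∈ configs V t, F C) / (configs V t).card

open Classical in
/-- The indicator of a proposition, as a real number. -/
noncomputable def ind (p : Prop) : ℝ := if p then 1 else 0

lemma ind_true {p : Prop} (h : p) : ind p = 1 := if_pos h

lemma ind_false {p : Prop} (h : ¬ p) : ind p = 0 := if_neg h

lemma ind_nonneg (p : Prop) : 0 ≤ ind p := by unfold ind; split_ifs <;> norm_num

lemma ind_le_one (p : Prop) : ind p ≤ 1 := by unfold ind; split_ifs <;> norm_num

/-- The probability that a uniformly random configuration of `t` pebbles satisfies `A`. -/
noncomputable def prob (t : ℕ) (A : (V → ℕ) → Prop) : ℝ :=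
  average t fun C => ind (A C)

lemma solvableProb_eq_prob (G : SimpleGraph V) (t : ℕ) :
    solvableProb G t = prob t (Solvable G) := by
  simp [solvableProb, prob, average, ind]

lemma average_mono {t : ℕ} {F F' : (V → ℕ) → ℝ} (h : ∀ C, ∑ v, C v = t → F C ≤ F' C) :
    average t F ≤ average t F' :=
  div_le_div_of_nonneg_right (Finset.sum_le_sum fun C hC => h C (mem_configs.1 hC))
    (Nat.cast_nonneg _)

lemma average_add (t : ℕ) (F F' : (V → ℕ) → ℝ) :
    average t (fun C => F C + F' C) = average t F + average t F' := by
  simp [average, Finset.sum_add_distrib, add_div]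

lemma average_const_mul (t : ℕ) (a : ℝ) (F : (V → ℕ) → ℝ) :
    average t (fun C => a * F C) = a * average t F := by
  simp [average, ← Finset.mul_sum, mul_div_assoc]

lemma average_const [Nonempty V] (t : ℕ) (a : ℝ) : average (V := V) t (fun _ => a) = a := by
  have : ((configs V t).card : ℝ) ≠ 0 := by
    exact_mod_cast (Finset.card_pos.2 (configs_nonempty t)).ne'
  simp [average, this]

lemma prob_nonneg (t : ℕ) (A : (V → ℕ) → Prop) : 0 ≤ prob t A :=
  div_nonneg (Finset.sum_nonneg fun _ _ => ind_nonneg _) (Nat.cast_nonneg _)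

lemma prob_mono {t : ℕ} {A B : (V → ℕ) → Prop} (h : ∀ C, ∑ v, C v = t → A C → B C) :
    prob t A ≤ prob t B :=
  average_mono fun C hC => by
    by_cases hA : A C
    · rw [ind_true hA, ind_true (h C hC hA)]
    · rw [ind_false hA]; exact ind_nonneg _

lemma prob_le_one [Nonempty V] (t : ℕ) (A : (V → ℕ) → Prop) : prob t A ≤ 1 :=
  (average_mono fun _ _ => ind_le_one _).trans_eq (average_const t 1)

lemma prob_not [Nonempty V] (t : ℕ) (A : (V → ℕ) → Prop) :
    prob t (fun C => ¬ A C) = 1 - prob t A := by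
  rw [eq_sub_iff_add_eq, prob, prob, ← average_add]
  refine Eq.trans ?_ (average_const (V := V) t 1)
  congr 1; ext C; by_cases h : A C <;> simp [ind, h]

lemma prob_exists_le {ι : Type*} (s : Finset ι) (t : ℕ) (A : ι → (V → ℕ) → Prop) :
    prob t (fun C => ∃ i ∈ s, A i C) ≤ ∑ i ∈ s, prob t (A i) := by
  classical
  simp only [prob, average, ← Finset.sum_div]
  rw [Finset.sum_comm]
  refine div_le_div_of_nonneg_right (Finset.sum_le_sum fun C _ => ?_) (Nat.cast_nonneg _)
  by_cases h : ∃ i ∈ s, A i C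
  · obtain ⟨i, hi, hA⟩ := h
    rw [ind_true ⟨i, hi, hA⟩, ← ind_true hA]
    exact Finset.single_le_sum (f := fun i => ind (A i C)) (fun i _ => ind_nonneg _) hi
  · rw [ind_false h]
    exact Finset.sum_nonneg fun i _ => ind_nonneg _

lemma sum_mul_ind_le {W : Type*} [Fintype W] (C : W → ℕ) (p : W → Prop) :
    ∑ v, ((C v : ℝ) + 1) * ind (p v) ≤ ∑ v, ((C v : ℝ) + 1) :=
  Finset.sum_le_sum fun v _ => mul_le_of_le_one_right (by positivity) (ind_le_one _)

lemma sum_add_one_eq {W : Type*} [Fintype W] (C : W → ℕ) :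
    ∑ v, ((C v : ℝ) + 1) = (∑ v, C v : ℕ) + Fintype.card W := by
  simp [Finset.sum_add_distrib]

/-- Adding a pebble at `v` with weight `C v + 1` to a uniformly random configuration produces
the uniform distribution (Pólya's urn). -/
lemma sum_configs_succ (t : ℕ) (F : (V → ℕ) → ℝ) :
    ∑ D ∈ configs V (t + 1), ((t : ℝ) + 1) * F D =
      ∑ C ∈ configs V t, ∑ v, ((C v : ℝ) + 1) * F (C + Pi.single v 1) := by
  -- Double counting of configurations with a marked pebble: removing a pebble from `v` turns the
  -- weight `D v` into `C v + 1`.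
  have h1 : ∀ D ∈ configs V (t + 1), ((t : ℝ) + 1) * F D = ∑ v, (D v : ℝ) * F D := by
    intro D hD
    rw [← Finset.sum_mul, ← Nat.cast_sum, mem_configs.1 hD]
    push_cast; rfl
  rw [Finset.sum_congr rfl h1, Finset.sum_comm, Finset.sum_comm (s := configs V t)]
  refine Finset.sum_congr rfl fun v _ => ?_
  rw [← Finset.sum_filter_add_sum_filter_not (configs V (t + 1)) (fun D => 1 ≤ D v)]
  have h2 : ∑ D ∈ configs V (t + 1) with ¬ 1 ≤ D v, (D v : ℝ) * F D = 0 := by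
    refine Finset.sum_eq_zero fun D hD => ?_
    have : D v = 0 := by have := (Finset.mem_filter.1 hD).2; omega
    simp [this]
  rw [h2, add_zero]
  have hback : ∀ D : V → ℕ, 1 ≤ D v → D - Pi.single v 1 + Pi.single v 1 = D := by
    intro D hD
    ext u
    by_cases h : u = v
    · subst h; simp; omega
    · simp [h]
  refine Finset.sum_bij' (fun D _ => D - Pi.single v 1) (fun C _ => C + Pi.single v 1)
    ?_ ?_ ?_ ?_ ?_
  · intro D hD
    obtain ⟨hD, h⟩ := Finset.mem_filter.1 hD
    rw [mem_configs] at hD ⊢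
    rw [← hback D h] at hD
    simpa [Finset.sum_add_distrib] using hD
  · intro C hC
    rw [mem_configs] at hC
    simp [mem_configs, Finset.sum_add_distrib, hC]
  · intro D hD
    exact hback D (Finset.mem_filter.1 hD).2
  · intro C hC
    ext u; simp
  · intro D hD
    have h := (Finset.mem_filter.1 hD).2
    rw [hback D h]
    simp [Nat.cast_sub h]

/-- The urn identity for `F = 1` gives the ratio of the two numbers of configurations, which
normalises the identity for general `F`. -/
lemma average_succ [Nonempty V] (t : ℕ) (F : (V → ℕ) → ℝ) :
    average (t + 1) F = average t fun C =>
      (∑ v, ((C v : ℝ) + 1) * F (C + Pi.single v 1)) / (t + Fintype.card V) := by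
  have hpos : (0 : ℝ) < t + Fintype.card V := by
    have : 0 < Fintype.card V := Fintype.card_pos
    positivity
  have hc : ∀ t, ((configs V t).card : ℝ) ≠ 0 := fun t => by
    exact_mod_cast (Finset.card_pos.2 (configs_nonempty t)).ne'
  have h1 := sum_configs_succ (V := V) t fun _ => 1
  have h2 : ∑ C ∈ configs V t, ∑ v, ((C v : ℝ) + 1) * 1 =
      (configs V t).card * ((t : ℝ) + Fintype.card V) := by
    rw [← nsmul_eq_mul, ← Finset.sum_const]
    refine Finset.sum_congr rfl fun C hC => ?_
    simp only [mul_one]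
    rw [sum_add_one_eq, mem_configs.1 hC]
  have h3 := sum_configs_succ (V := V) t F
  rw [h2, Finset.sum_const, nsmul_eq_mul, mul_one] at h1
  rw [← Finset.mul_sum] at h3
  unfold average
  rw [← Finset.sum_div, ← h3, div_div, div_eq_div_iff (hc _) (mul_ne_zero hpos.ne' (hc _))]
  linear_combination -(∑ D ∈ configs V (t + 1), F D) * h1

/-- One step of sprinkling. -/
lemma prob_not_succ_le [Nonempty V] {A A' : (V → ℕ) → Prop}
    (hA' : ∀ C v, A' C → A' (C + Pi.single v 1)) {w q : ℝ} (hq : 0 ≤ q)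
    (hw : ∀ C, A C → ¬ A' C → ∃ s : Finset V, w ≤ s.card ∧ ∀ v ∈ s, A' (C + Pi.single v 1))
    (t : ℕ) (hqw : q * (t + Fintype.card V) ≤ w) :
    prob (t + 1) (fun C => ¬ A' C) ≤
      (1 - q) * prob t (fun C => ¬ A' C) + q * prob t (fun C => ¬ A C) := by
  classical
  have hpos : (0 : ℝ) < t + Fintype.card V := by
    have : 0 < Fintype.card V := Fintype.card_pos
    positivity
  unfold prob
  rw [average_succ, ← average_const_mul, ← average_const_mul, ← average_add]
  refine average_mono fun C hC => ?_
  have htot : ∑ v, ((C v : ℝ) + 1) = t + Fintype.card V := by rw [sum_add_one_eq, hC]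
  rw [div_le_iff₀ hpos]
  by_cases h' : A' C
  · have h0 : ∑ v, ((C v : ℝ) + 1) * ind (¬ A' (C + Pi.single v 1)) = 0 :=
      Finset.sum_eq_zero fun v _ => by rw [ind_false (not_not.2 (hA' C v h')), mul_zero]
    rw [h0, ind_false (not_not.2 h'), mul_zero, zero_add]
    exact mul_nonneg (mul_nonneg hq (ind_nonneg _)) hpos.le
  rw [ind_true h']
  by_cases h : A C
  · obtain ⟨s, hs, hsA⟩ := hw C h h'
    -- Each vertex of `s` has urn weight at least `1`, so the new pebble lands in `s` with
    -- probability at least `w / (t + |V|) ≥ q`.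
    have h1 : ∑ v, ((C v : ℝ) + 1) * ind (¬ A' (C + Pi.single v 1)) ≤
        ∑ v, ((C v : ℝ) + 1) - ∑ v, (if v ∈ s then (1 : ℝ) else 0) := by
      rw [← Finset.sum_sub_distrib]
      refine Finset.sum_le_sum fun v _ => ?_
      have : (0 : ℝ) ≤ C v := Nat.cast_nonneg _
      by_cases hv : v ∈ s
      · rw [ind_false (not_not.2 (hsA v hv)), if_pos hv]; linarith
      · rw [if_neg hv, sub_zero]
        exact mul_le_of_le_one_right (by positivity) (ind_le_one _)
    rw [htot] at h1
    simp only [Finset.sum_boole, Finset.filter_mem_eq_inter, Finset.univ_inter] at h1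
    rw [ind_false (not_not.2 h)]
    linarith
  · rw [ind_true h]
    refine (sum_mul_ind_le C _).trans_eq ?_
    rw [htot]; ring

lemma prob_not_antitone [Nonempty V] {A : (V → ℕ) → Prop}
    (hA : ∀ C v, A C → A (C + Pi.single v 1)) :
    Antitone fun t => prob t fun C => ¬ A C :=
  antitone_nat_of_succ_le fun t => by
    simpa using prob_not_succ_le (A := A) hA (w := 0) le_rfl
      (fun C h h' => absurd h h') t (by simp)

/-- Sprinkling `k` more pebbles: if every configuration in `A` but not in `A'` enters `A'` by
adding a pebble at any one of at least `w` vertices, then `A'` fails after `k` more pebbles with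
probability exponentially small in `k`, up to the failure probability of `A`. -/
lemma prob_not_add_le [Nonempty V] {A A' : (V → ℕ) → Prop}
    (hA : ∀ C v, A C → A (C + Pi.single v 1))
    (hA' : ∀ C v, A' C → A' (C + Pi.single v 1)) {w q : ℝ} (hq : 0 ≤ q) (hq1 : q ≤ 1)
    (hw : ∀ C, A C → ¬ A' C → ∃ s : Finset V, w ≤ s.card ∧ ∀ v ∈ s, A' (C + Pi.single v 1))
    (t k : ℕ) (hqw : q * (t + k + Fintype.card V) ≤ w) :
    prob (t + k) (fun C => ¬ A' C) ≤ (1 - q) ^ k + prob t (fun C => ¬ A C) := by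
  induction k with
  | zero => simpa using (prob_le_one t _).trans (le_add_of_nonneg_right (prob_nonneg t _))
  | succ k ih =>
    push_cast at hqw
    have ih := ih (by nlinarith)
    have h1 := prob_not_succ_le hA' hq hw (t + k) (by push_cast; nlinarith)
    have h2 := prob_not_antitone hA (Nat.le_add_right t k)
    simp only at h2
    have h3 := mul_le_mul_of_nonneg_left ih (sub_nonneg.2 hq1)
    have h4 := mul_le_mul_of_nonneg_left h2 hq
    rw [← add_assoc, pow_succ]
    linarith

/-- Sprinkling from the empty configuration with trivial `A`: while `X` is empty, each new pebble
hits it with probability at least `q`. -/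
lemma prob_forall_eq_zero_le [Nonempty V] (X : Finset V) {q : ℝ} (hq : 0 ≤ q) (hq1 : q ≤ 1)
    (t : ℕ) (hqw : q * (t + Fintype.card V) ≤ X.card) :
    prob t (fun C => ∀ x ∈ X, C x = 0) ≤ (1 - q) ^ t := by
  have h := prob_not_add_le (V := V) (A := fun _ => True) (A' := fun C => ∃ x ∈ X, 1 ≤ C x)
    (fun _ _ _ => trivial)
    (fun C v ⟨x, hx, h⟩ => ⟨x, hx, h.trans (by simp)⟩) hq hq1
    (fun C _ _ => ⟨X, le_rfl, fun v hv => ⟨v, hv, by simp⟩⟩) 0 t (by simpa using hqw)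
  have h0 : prob (V := V) 0 (fun _ => ¬ True) = 0 := by simp [prob, average, ind]
  rw [zero_add, h0, add_zero] at h
  refine (prob_mono fun C _ hC => ?_).trans h
  rintro ⟨x, hx, h⟩
  have := hC x hx
  omega

/-- While all pebbles are on distinct vertices, each occupied vertex has urn weight `2`, so the next
pebble collides with probability `2t / (t + |V|)`. These increments sum to at most `t ^ 2 / |V|`. -/
lemma prob_exists_two_le [Nonempty V] (t : ℕ) :
    prob (V := V) t (fun C => ∃ v, 2 ≤ C v) ≤ (t : ℝ) ^ 2 / Fintype.card V := by
  classical
  have hN : (0 : ℝ) < Fintype.card V := by exact_mod_cast Fintype.card_pos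
  induction t with
  | zero =>
    have : prob (V := V) 0 (fun C => ∃ v, 2 ≤ C v) ≤ prob (V := V) 0 (fun _ => False) := by
      refine prob_mono fun C hC ⟨v, hv⟩ => ?_
      have := (Finset.sum_eq_zero_iff.1 hC) v (Finset.mem_univ v)
      omega
    refine this.trans ?_
    simp [prob, average, ind]
  | succ t ih =>
    have hpos : (0 : ℝ) < t + Fintype.card V := by positivity
    have key : prob (V := V) (t + 1) (fun C => ∃ v, 2 ≤ C v) ≤
        prob (V := V) t (fun C => ∃ v, 2 ≤ C v) + 2 * t / (t + Fintype.card V) := by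
      unfold prob
      rw [average_succ, ← average_const (V := V) t (2 * t / (t + Fintype.card V)), ← average_add]
      refine average_mono fun C hC => ?_
      have htot : ∑ v, ((C v : ℝ) + 1) = t + Fintype.card V := by rw [sum_add_one_eq, hC]
      by_cases h : ∃ v, 2 ≤ C v
      · rw [ind_true h]
        exact ((div_le_one hpos).2 ((sum_mul_ind_le C _).trans_eq htot)).trans
          (le_add_of_nonneg_right (by positivity))
      · rw [ind_false h, zero_add]
        refine div_le_div_of_nonneg_right ?_ hpos.le
        have h2 : (2 : ℝ) * t = ∑ v, 2 * (C v : ℝ) := by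
          rw [← Finset.mul_sum, ← Nat.cast_sum, hC]
        rw [h2]
        refine Finset.sum_le_sum fun v _ => ?_
        push Not at h
        have hv := h v
        by_cases hu : ∃ u, 2 ≤ (C + Pi.single v 1 : V → ℕ) u
        · rw [ind_true hu]
          obtain ⟨u, hu⟩ := hu
          by_cases huv : u = v
          · subst huv
            have : C u = 1 := by simp at hu; omega
            simp [this]; norm_num
          · have := h u
            simp [huv] at hu; omega
        · rw [ind_false hu, mul_zero]; positivity
    refine key.trans ((add_le_add_left ih _).trans ?_)
    have h3 : 2 * (t : ℝ) / (t + Fintype.card V) ≤ 2 * t / Fintype.card V :=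
      div_le_div_of_nonneg_left (by positivity) hN (by simp)
    refine (add_le_add_right h3 _).trans ?_
    rw [← add_div]
    refine div_le_div_of_nonneg_right ?_ hN.le
    push_cast; nlinarith

lemma not_solvable_of_le_one (G : SimpleGraph V) {C : V → ℕ} (h1 : ∀ v, C v ≤ 1)
    (hlt : ∑ v, C v < Fintype.card V) : ¬ Solvable G C := by
  intro hs
  obtain ⟨r, hr⟩ : ∃ r, C r = 0 := by
    by_contra! h
    have : ∑ _v : V, 1 ≤ ∑ v, C v := Finset.sum_le_sum fun v _ => Nat.one_le_iff_ne_zero.2 (h v)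
    simp at this; omega
  obtain ⟨D, hD, hDr⟩ := hs r
  rcases Relation.ReflTransGen.cases_head hD with rfl | ⟨E, ⟨u, v, _, hu, _⟩, _⟩
  · omega
  · have := h1 u; omega

lemma solvableProb_le [Nonempty V] (G : SimpleGraph V) {t : ℕ} (ht : t < Fintype.card V) :
    solvableProb G t ≤ (t : ℝ) ^ 2 / Fintype.card V := by
  rw [solvableProb_eq_prob]
  refine (prob_mono fun C hC hs => ?_).trans (prob_exists_two_le t)
  by_contra! h
  exact not_solvable_of_le_one G (fun v => Nat.le_of_lt_succ (h v)) (hC ▸ ht) hs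

end Average

/-! ### Occupied walks and moving pebbles along them -/

section Linked

variable {V : Type*} {G : SimpleGraph V}

/-- `x` and `y` are joined by a walk all of whose vertices carry a pebble. -/
def Linked (G : SimpleGraph V) (C : V → ℕ) (x y : V) : Prop :=
  ∃ p : G.Walk x y, ∀ z ∈ p.support, 1 ≤ C z

lemma Linked.refl {C : V → ℕ} {x : V} (h : 1 ≤ C x) : Linked G C x x :=
  ⟨.nil, by simpa using h⟩

lemma Linked.symm {C : V → ℕ} {x y : V} (h : Linked G C x y) : Linked G C y x := by
  obtain ⟨p, hp⟩ := h
  exact ⟨p.reverse, by simpa using hp⟩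

lemma Linked.trans {C : V → ℕ} {x y z : V} (h : Linked G C x y) (h' : Linked G C y z) :
    Linked G C x z := by
  obtain ⟨p, hp⟩ := h
  obtain ⟨q, hq⟩ := h'
  refine ⟨p.append q, fun u hu => ?_⟩
  rcases SimpleGraph.Walk.mem_support_append_iff p q |>.1 hu with h | h
  exacts [hp u h, hq u h]

lemma Linked.of_adj {C : V → ℕ} {x y : V} (h : G.Adj x y) (hx : 1 ≤ C x) (hy : 1 ≤ C y) :
    Linked G C x y :=
  ⟨h.toWalk, by simp [hx, hy]⟩

lemma Linked.mono {C D : V → ℕ} (hCD : C ≤ D) {x y : V} (h : Linked G C x y) :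
    Linked G D x y := by
  obtain ⟨p, hp⟩ := h
  exact ⟨p, fun z hz => (hp z hz).trans (hCD z)⟩

variable [DecidableEq V]

/-- The configuration obtained from `C` by a pebbling step from `u` to `v`. -/
def move (C : V → ℕ) (u v : V) : V → ℕ :=
  Function.update (Function.update C u (C u - 2)) v (C v + 1)

lemma step_move {C : V → ℕ} {u v : V} (h : G.Adj u v) (hu : 2 ≤ C u) : Step G C (move C u v) :=
  ⟨u, v, h, hu, rfl⟩

lemma move_target (C : V → ℕ) (u v : V) : move C u v v = C v + 1 := by simp [move]

lemma move_of_ne (C : V → ℕ) {u v z : V} (hzu : z ≠ u) (hzv : z ≠ v) : move C u v z = C z := by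
  simp [move, hzu, hzv]

lemma le_move_of_ne (C : V → ℕ) {u z : V} (v : V) (hzu : z ≠ u) : C z ≤ move C u v z := by
  by_cases h : z = v
  · subst h; simp [move_target]
  · rw [move_of_ne C hzu h]

/-- Two pebbles at the start of an occupied path travel along it until they are next to its
end, whose pebbles are not touched. -/
lemma exists_adj_two_of_path {x y : V} (p : G.Walk y x) :
    ∀ C : V → ℕ, p.IsPath → (∀ z ∈ p.support, 1 ≤ C z) → 2 ≤ C y → 2 ≤ C x → y ≠ x →
      ∃ D e, Relation.ReflTransGen (Step G) C D ∧ G.Adj e x ∧ 2 ≤ D e ∧ 2 ≤ D x := by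
  induction p with
  | nil => intro C _ _ _ _ h; exact absurd rfl h
  | @cons a b c hab p ih =>
    intro C hp hocc ha hc hac
    rw [SimpleGraph.Walk.cons_isPath_iff] at hp
    by_cases hbc : b = c
    · subst hbc
      -- Stopping one edge early keeps the two pebbles on both ends of that edge.
      exact ⟨C, a, .refl, hab, ha, hc⟩
    · have hne : ∀ z ∈ p.support, z ≠ a := fun z hz h => hp.2 (h ▸ hz)
      obtain ⟨D, e, hD, h⟩ := ih (move C a b) hp.1
        (fun z hz => (hocc z (by simp [hz])).trans (le_move_of_ne C b (hne z hz)))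
        (by
          have := hocc b (by simp)
          rw [move_target]; omega)
        (hc.trans (le_move_of_ne C b hac.symm)) hbc
      exact ⟨D, e, .head (step_move hab ha) hD, h⟩

/-- Two pebbles on each of two vertices `x`, `e` in the closed neighbourhood of `z` solve every
root in the closed neighbourhood of `z`. -/
lemma rootSolvable_of_two_two {C : V → ℕ} {x e z r : V} (hxe : x ≠ e) (hx : 2 ≤ C x)
    (he : 2 ≤ C e) (hxz : x = z ∨ G.Adj x z) (hez : e = z ∨ G.Adj e z) (hzr : z = r ∨ G.Adj z r) :
    RootSolvable G C r := by
  obtain ⟨D, hD, hz⟩ : ∃ D, Relation.ReflTransGen (Step G) C D ∧ 2 ≤ D z := by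
    rcases hxz with rfl | hxz
    · exact ⟨C, .refl, hx⟩
    rcases hez with rfl | hez
    · exact ⟨C, .refl, he⟩
    refine ⟨move (move C x z) e z, .tail (.single (step_move hxz hx))
      (step_move hez (he.trans (le_move_of_ne C z hxe.symm))), ?_⟩
    rw [move_target, move_target]; omega
  rcases hzr with rfl | hzr
  · exact ⟨D, hD, by omega⟩
  · exact ⟨move D z r, hD.tail (step_move hzr hz), by rw [move_target]; omega⟩

lemma rootSolvable_of_reflTransGen {C D : V → ℕ} {r : V}
    (h : Relation.ReflTransGen (Step G) C D) (hD : RootSolvable G D r) : RootSolvable G C r := by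
  obtain ⟨E, hE, hr⟩ := hD
  exact ⟨E, h.trans hE, hr⟩

end Linked

/-! ### Solving every root of the square -/

section CliqueSquare

variable {n : ℕ}

lemma cliqueSquare_adj {x y : Fin n × Fin n} :
    (cliqueSquare n).Adj x y ↔ x ≠ y ∧ (x.1 = y.1 ∨ x.2 = y.2) := by
  simp only [cliqueSquare, clique, SimpleGraph.boxProd_adj, SimpleGraph.top_adj, ne_eq,
    Prod.ext_iff]
  tauto

lemma eq_or_cliqueSquare_adj {x y : Fin n × Fin n} (h : x.1 = y.1 ∨ x.2 = y.2) :
    x = y ∨ (cliqueSquare n).Adj x y := by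
  rw [cliqueSquare_adj]; tauto

/-- The pairs of pebbles are brought to two cells of a common line. Any root has a cell `z` of that
line in a perpendicular line through it; both pairs send one pebble to `z` (unless it already has
two), and `z` reaches the root. -/
lemma solvable_of_linked_two {C : Fin n × Fin n → ℕ} {x y : Fin n × Fin n}
    (hxy : Linked (cliqueSquare n) C y x) (hne : y ≠ x) (hy : 2 ≤ C y) (hx : 2 ≤ C x) :
    Solvable (cliqueSquare n) C := by
  intro r
  obtain ⟨p, hp⟩ := hxy
  obtain ⟨D, e, hD, hex, he, hx⟩ := exists_adj_two_of_path p.bypass C p.bypass_isPath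
    (fun z hz => hp z (p.support_bypass_subset_support hz)) hy hx hne
  refine rootSolvable_of_reflTransGen hD ?_
  obtain ⟨hne', h | h⟩ := cliqueSquare_adj.1 hex
  · exact rootSolvable_of_two_two (z := (x.1, r.2)) hne' he hx
      (eq_or_cliqueSquare_adj (.inl h)) (eq_or_cliqueSquare_adj (.inl rfl))
      (eq_or_cliqueSquare_adj (.inr rfl))
  · exact rootSolvable_of_two_two (z := (r.1, x.2)) hne' he hx
      (eq_or_cliqueSquare_adj (.inr h)) (eq_or_cliqueSquare_adj (.inr rfl))
      (eq_or_cliqueSquare_adj (.inl rfl))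

/-! ### Occupied cuts force a giant component -/

/-- The cells with exactly one of their coordinates in the prescribed sets. -/
def crossing (U W : Finset (Fin n)) : Finset (Fin n × Fin n) := U ×ˢ Wᶜ ∪ Uᶜ ×ˢ W

lemma mem_crossing {U W : Finset (Fin n)} {x : Fin n × Fin n} :
    x ∈ crossing U W ↔ (x.1 ∈ U ∧ x.2 ∉ W) ∨ (x.1 ∉ U ∧ x.2 ∈ W) := by
  simp [crossing]

lemma card_crossing (U W : Finset (Fin n)) :
    ((crossing U W).card : ℝ) = U.card * (n - W.card) + (n - U.card) * W.card := by
  have hd : Disjoint (U ×ˢ Wᶜ) (Uᶜ ×ˢ W) := by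
    rw [Finset.disjoint_left]
    intro x
    simp only [Finset.mem_product, Finset.mem_compl]
    tauto
  have hc : ∀ S : Finset (Fin n), ((Sᶜ.card : ℕ) : ℝ) = n - S.card := fun S => by
    rw [Finset.card_compl, Fintype.card_fin, Nat.cast_sub]
    simpa using S.card_le_univ
  rw [crossing, Finset.card_union_of_disjoint hd, Finset.card_product, Finset.card_product]
  push_cast
  rw [hc, hc]

/-- Every cut with at least `4 / 9` of all cells crossing it is crossed by a pebble. -/
def CutsOccupied (C : Fin n × Fin n → ℕ) : Prop :=
  ∀ U W : Finset (Fin n), 4 / 9 * (n : ℝ) ^ 2 ≤ (crossing U W).card →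
    ∃ x ∈ crossing U W, 1 ≤ C x

/-- The set `K` is occupied and contains every occupied cell in a line with one of its cells. -/
def OccClosed (C : Fin n × Fin n → ℕ) (K : Finset (Fin n × Fin n)) : Prop :=
  (∀ x ∈ K, 1 ≤ C x) ∧ ∀ x ∈ K, ∀ y, 1 ≤ C y → (x.1 = y.1 ∨ x.2 = y.2) → y ∈ K

/-- The number of lines that meet `K`. -/
def lineCount (K : Finset (Fin n × Fin n)) : ℕ :=
  (K.image Prod.fst).card + (K.image Prod.snd).card

lemma lineCount_union_le (K L : Finset (Fin n × Fin n)) :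
    lineCount (K ∪ L) ≤ lineCount K + lineCount L := by
  unfold lineCount
  rw [Finset.image_union, Finset.image_union]
  have := Finset.card_union_le (K.image Prod.fst) (L.image Prod.fst)
  have := Finset.card_union_le (K.image Prod.snd) (L.image Prod.snd)
  omega

/-- An occupied crossing cell would lie in exactly one line met by `K`, but closedness puts it in
`K`. -/
lemma OccClosed.card_crossing_lt {C : Fin n × Fin n → ℕ} (hC : CutsOccupied C)
    {K : Finset (Fin n × Fin n)} (hK : OccClosed C K) :
    ((crossing (K.image Prod.fst) (K.image Prod.snd)).card : ℝ) < 4 / 9 * (n : ℝ) ^ 2 := by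
  by_contra! h
  obtain ⟨x, hx, hCx⟩ := hC _ _ h
  rcases mem_crossing.1 hx with ⟨h1, h2⟩ | ⟨h2, h1⟩
  · obtain ⟨y, hy, hyx⟩ := Finset.mem_image.1 h1
    exact h2 (Finset.mem_image_of_mem _ (hK.2 y hy x hCx (.inl hyx)))
  · obtain ⟨y, hy, hyx⟩ := Finset.mem_image.1 h1
    exact h2 (Finset.mem_image_of_mem _ (hK.2 y hy x hCx (.inr hyx)))

/-- With `a` rows, `b` columns and `s = a + b`, the cut has `n s - 2ab ≥ n s - s ^ 2 / 2` cells.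
This is at least `4 n ^ 2 / 9` for `2n / 3 ≤ s ≤ 4n / 3`, with equality at both ends. -/
lemma OccClosed.lineCount_dichotomy {C : Fin n × Fin n → ℕ} (hC : CutsOccupied C)
    {K : Finset (Fin n × Fin n)} (hK : OccClosed C K) :
    3 * lineCount K < 2 * n ∨ 4 * n < 3 * lineCount K := by
  have h := hK.card_crossing_lt hC
  rw [card_crossing] at h
  by_contra! h'
  obtain ⟨h1, h2⟩ := h'
  have h1' : 2 * (n : ℝ) ≤ 3 * lineCount K := by exact_mod_cast h1
  have h2' : 3 * (lineCount K : ℝ) ≤ 4 * n := by exact_mod_cast h2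
  unfold lineCount at h1' h2'
  push_cast at h1' h2'
  nlinarith [sq_nonneg (((K.image Prod.fst).card : ℝ) - (K.image Prod.snd).card)]

/-- The set of all occupied cells. -/
def occupied (C : Fin n × Fin n → ℕ) : Finset (Fin n × Fin n) := Finset.univ.filter fun x => 1 ≤ C x

lemma occClosed_occupied (C : Fin n × Fin n → ℕ) : OccClosed C (occupied C) :=
  ⟨fun x hx => (Finset.mem_filter.1 hx).2, fun _ _ y hy _ => by simpa [occupied] using hy⟩

/-- The empty rows against no columns form an unoccupied cut, so fewer than `4n / 9` rows are empty;
likewise for columns. -/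
lemma le_lineCount_occupied {C : Fin n × Fin n → ℕ} (hC : CutsOccupied C) :
    2 * n ≤ 3 * lineCount (occupied C) := by
  have h1 : 5 / 9 * (n : ℝ) ≤ ((occupied C).image Prod.fst).card := by
    by_contra! h
    obtain ⟨x, hx, hCx⟩ := hC ((occupied C).image Prod.fst)ᶜ ∅ (by
      rw [card_crossing, Finset.card_compl, Nat.cast_sub (Finset.card_le_univ _)]
      simp only [Fintype.card_fin, Finset.card_empty]
      push_cast
      nlinarith [(Nat.cast_nonneg n : (0 : ℝ) ≤ n)])
    have : x.1 ∉ (occupied C).image Prod.fst := by simpa [mem_crossing] using hx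
    exact this (Finset.mem_image_of_mem _ (by simpa [occupied] using hCx))
  have h2 : 5 / 9 * (n : ℝ) ≤ ((occupied C).image Prod.snd).card := by
    by_contra! h
    obtain ⟨x, hx, hCx⟩ := hC ∅ ((occupied C).image Prod.snd)ᶜ (by
      rw [card_crossing, Finset.card_compl, Nat.cast_sub (Finset.card_le_univ _)]
      simp only [Fintype.card_fin, Finset.card_empty]
      push_cast
      nlinarith [(Nat.cast_nonneg n : (0 : ℝ) ≤ n)])
    have : x.2 ∉ (occupied C).image Prod.snd := by simpa [mem_crossing] using hx
    exact this (Finset.mem_image_of_mem _ (by simpa [occupied] using hCx))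
  have : 2 * (n : ℝ) ≤ 3 * lineCount (occupied C) := by
    unfold lineCount
    push_cast
    linarith [(Nat.cast_nonneg n : (0 : ℝ) ≤ n)]
  exact_mod_cast this

/-- All cells of `K` are occupied and linked to each other. -/
def LinkedSet (C : Fin n × Fin n → ℕ) (K : Finset (Fin n × Fin n)) : Prop :=
  ∀ x ∈ K, ∀ y ∈ K, Linked (cliqueSquare n) C x y

lemma LinkedSet.one_le {C : Fin n × Fin n → ℕ} {K : Finset (Fin n × Fin n)} (h : LinkedSet C K)
    {x : Fin n × Fin n} (hx : x ∈ K) : 1 ≤ C x := by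
  obtain ⟨p, hp⟩ := h x hx x hx
  exact hp x (by simp)

lemma LinkedSet.mono {C D : Fin n × Fin n → ℕ} (hCD : C ≤ D) {K : Finset (Fin n × Fin n)}
    (h : LinkedSet C K) : LinkedSet D K :=
  fun x hx y hy => (h x hx y hy).mono hCD

/-- If all large cuts are occupied then there is a giant component. -/
lemma CutsOccupied.exists_linkedSet {C : Fin n × Fin n → ℕ} (hC : CutsOccupied C) :
    ∃ K, LinkedSet C K ∧ n ≤ 3 * K.card := by
  classical
  rcases Nat.eq_zero_or_pos n with rfl | hn
  · exact ⟨∅, by simp [LinkedSet], by simp⟩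
  -- A smallest closed set meeting at least `2n / 3` lines is connected: by the dichotomy it meets
  -- more than `4n / 3`, so if it split into two closed parts, one of them would still meet `2n /
  -- 3`.
  let S : Finset (Finset (Fin n × Fin n)) :=
    Finset.univ.filter fun K => OccClosed C K ∧ 2 * n ≤ 3 * lineCount K
  have hS : S.Nonempty :=
    ⟨occupied C, by simp [S, occClosed_occupied, le_lineCount_occupied hC]⟩
  obtain ⟨K, hKS, hmin⟩ := S.exists_min_image Finset.card hS
  obtain ⟨hK, hlarge⟩ : OccClosed C K ∧ 2 * n ≤ 3 * lineCount K := by simpa [S] using hKS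
  have hgiant : 4 * n < 3 * lineCount K := by
    rcases hK.lineCount_dichotomy hC with h | h <;> omega
  have hsmall : ∀ L, OccClosed C L → L.card < K.card → 3 * lineCount L < 2 * n := by
    intro L hL hcard
    by_contra! h
    have := hmin L (by simp [S, hL, h])
    omega
  refine ⟨K, fun x hx y hy => ?_, ?_⟩
  · by_contra hxy
    have hlink : ∀ u ∈ K, ∀ v, 1 ≤ C v → (u.1 = v.1 ∨ u.2 = v.2) →
        Linked (cliqueSquare n) C u v := by
      intro u hu v hv h
      rcases eq_or_cliqueSquare_adj h with rfl | h
      · exact .refl hv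
      · exact .of_adj h (hK.1 u hu) hv
    let K₁ := K.filter fun z => Linked (cliqueSquare n) C x z
    let K₂ := K.filter fun z => ¬ Linked (cliqueSquare n) C x z
    have h₁ : OccClosed C K₁ := by
      refine ⟨fun u hu => hK.1 u (Finset.mem_filter.1 hu).1, fun u hu v hv h => ?_⟩
      obtain ⟨hu, hxu⟩ := Finset.mem_filter.1 hu
      exact Finset.mem_filter.2 ⟨hK.2 u hu v hv h, hxu.trans (hlink u hu v hv h)⟩
    have h₂ : OccClosed C K₂ := by
      refine ⟨fun u hu => hK.1 u (Finset.mem_filter.1 hu).1, fun u hu v hv h => ?_⟩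
      obtain ⟨hu, hxu⟩ := Finset.mem_filter.1 hu
      exact Finset.mem_filter.2 ⟨hK.2 u hu v hv h,
        fun hxv => hxu (hxv.trans (hlink u hu v hv h).symm)⟩
    have hun : K₁ ∪ K₂ = K := Finset.filter_union_filter_not_eq _ K
    have hc₁ : K₁.card < K.card :=
      Finset.card_lt_card (Finset.filter_ssubset.2 ⟨y, hy, hxy⟩)
    have hc₂ : K₂.card < K.card :=
      Finset.card_lt_card (Finset.filter_ssubset.2 ⟨x, hx, not_not.2 (.refl (hK.1 x hx))⟩)
    have := hsmall K₁ h₁ hc₁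
    have := hsmall K₂ h₂ hc₂
    have := lineCount_union_le K₁ K₂
    rw [hun] at this
    omega
  · have h1 : (K.image Prod.fst).card ≤ K.card := Finset.card_image_le
    have h2 : (K.image Prod.snd).card ≤ K.card := Finset.card_image_le
    unfold lineCount at hgiant
    omega

end CliqueSquare

/-! ### Probability of a giant component and of two doubled cells in it -/

section Giant

variable {n : ℕ}

lemma prob_not_cutsOccupied_le (hn : 6 ≤ n) :
    prob (V := Fin n × Fin n) (6 * n) (fun C => ¬ CutsOccupied C) ≤ (4 * (7 / 9 : ℝ) ^ 6) ^ n := by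
  have : Nonempty (Fin n) := ⟨⟨0, by omega⟩⟩
  have hn' : (6 : ℝ) ≤ n := by exact_mod_cast hn
  let S : Finset (Finset (Fin n) × Finset (Fin n)) :=
    Finset.univ.filter fun p => 4 / 9 * (n : ℝ) ^ 2 ≤ (crossing p.1 p.2).card
  have h1 : prob (V := Fin n × Fin n) (6 * n) (fun C => ¬ CutsOccupied C) ≤
      prob (6 * n) (fun C => ∃ p ∈ S, ∀ x ∈ crossing p.1 p.2, C x = 0) := by
    refine prob_mono fun C _ hC => ?_
    unfold CutsOccupied at hC
    push Not at hC
    obtain ⟨U, W, h, hUW⟩ := hC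
    exact ⟨(U, W), by simpa [S] using h, fun x hx => by have := hUW x hx; omega⟩
  refine h1.trans ((prob_exists_le S _ _).trans ?_)
  have h2 : ∀ p ∈ S, prob (V := Fin n × Fin n) (6 * n)
      (fun C => ∀ x ∈ crossing p.1 p.2, C x = 0) ≤ (7 / 9 : ℝ) ^ (6 * n) := by
    intro p hp
    have hp : 4 / 9 * (n : ℝ) ^ 2 ≤ (crossing p.1 p.2).card := by simpa [S] using hp
    -- For `n ≥ 6` the total weight `6n + n ^ 2` is at most `2 n ^ 2`, so a cut of `4 n ^ 2 / 9`
    -- cells is hit with probability at least `2 / 9`. Six pebbles per line index suffice because `4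
    -- (7 / 9) ^ 6 < 1`.
    refine (prob_forall_eq_zero_le (q := 2 / 9) _ (by norm_num) (by norm_num) _ ?_).trans_eq
      (by norm_num)
    refine le_trans ?_ hp
    simp only [Fintype.card_prod, Fintype.card_fin]
    push_cast
    nlinarith
  refine (Finset.sum_le_card_nsmul S _ _ h2).trans ?_
  have h3 : (S.card : ℝ) ≤ 4 ^ n := by
    have : S.card ≤ 4 ^ n := (Finset.card_le_univ S).trans_eq (by
      simp [← mul_pow])
    exact_mod_cast this
  rw [nsmul_eq_mul, mul_pow, ← pow_mul]
  exact mul_le_mul_of_nonneg_right h3 (by positivity)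

/-- There is a linked set of at least `n / 3` cells. -/
def HasGiant (C : Fin n × Fin n → ℕ) : Prop :=
  ∃ K, LinkedSet C K ∧ n ≤ 3 * K.card

/-- There is a linked set of at least `n / 3` cells, one of which has two pebbles. -/
def HasGiantOne (C : Fin n × Fin n → ℕ) : Prop :=
  ∃ K, LinkedSet C K ∧ n ≤ 3 * K.card ∧ ∃ x ∈ K, 2 ≤ C x

/-- There is a linked set of cells, two of which have two pebbles. -/
def HasTwo (C : Fin n × Fin n → ℕ) : Prop :=
  ∃ K, LinkedSet C K ∧ ∃ x ∈ K, ∃ y ∈ K, x ≠ y ∧ 2 ≤ C x ∧ 2 ≤ C y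

lemma HasTwo.solvable {C : Fin n × Fin n → ℕ} (h : HasTwo C) : Solvable (cliqueSquare n) C := by
  obtain ⟨K, hK, x, hx, y, hy, hne, h2x, h2y⟩ := h
  exact solvable_of_linked_two (hK x hx y hy) hne h2x h2y

lemma le_add_single (C : Fin n × Fin n → ℕ) (v : Fin n × Fin n) : C ≤ C + Pi.single v 1 :=
  le_self_add

lemma HasGiant.add_single (C : Fin n × Fin n → ℕ) (v : Fin n × Fin n) (h : HasGiant C) :
    HasGiant (C + Pi.single v 1) := by
  obtain ⟨K, hK, h⟩ := h
  exact ⟨K, hK.mono (le_add_single C v), h⟩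

lemma HasGiantOne.add_single (C : Fin n × Fin n → ℕ) (v : Fin n × Fin n) (h : HasGiantOne C) :
    HasGiantOne (C + Pi.single v 1) := by
  obtain ⟨K, hK, h, x, hx, h2⟩ := h
  exact ⟨K, hK.mono (le_add_single C v), h, x, hx, h2.trans (le_add_single C v x)⟩

lemma HasTwo.add_single (C : Fin n × Fin n → ℕ) (v : Fin n × Fin n) (h : HasTwo C) :
    HasTwo (C + Pi.single v 1) := by
  obtain ⟨K, hK, x, hx, y, hy, hne, h2x, h2y⟩ := h
  exact ⟨K, hK.mono (le_add_single C v), x, hx, y, hy, hne, h2x.trans (le_add_single C v x),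
    h2y.trans (le_add_single C v y)⟩

lemma HasGiant.exists_hasGiantOne {C : Fin n × Fin n → ℕ} (h : HasGiant C) :
    ∃ s : Finset (Fin n × Fin n), (n : ℝ) / 6 ≤ s.card ∧
      ∀ v ∈ s, HasGiantOne (C + Pi.single v 1) := by
  obtain ⟨K, hK, h⟩ := h
  have h' : (n : ℝ) ≤ 3 * K.card := by exact_mod_cast h
  refine ⟨K, by linarith [(Nat.cast_nonneg n : (0 : ℝ) ≤ n)], fun v hv =>
    ⟨K, hK.mono (le_add_single C v), h, v, hv, ?_⟩⟩
  have := hK.one_le hv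
  simp; omega

lemma HasGiantOne.exists_hasTwo (hn : 6 ≤ n) {C : Fin n × Fin n → ℕ} (h : HasGiantOne C) :
    ∃ s : Finset (Fin n × Fin n), (n : ℝ) / 6 ≤ s.card ∧
      ∀ v ∈ s, HasTwo (C + Pi.single v 1) := by
  obtain ⟨K, hK, h, x, hx, h2⟩ := h
  refine ⟨K.erase x, ?_, fun v hv => ?_⟩
  · have : n ≤ 6 * (K.erase x).card := by
      rw [Finset.card_erase_of_mem hx]; omega
    have : (n : ℝ) ≤ 6 * (K.erase x).card := by exact_mod_cast this
    linarith
  · obtain ⟨hvx, hv⟩ := Finset.mem_erase.1 hv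
    refine ⟨K, hK.mono (le_add_single C v), x, hx, v, hv, hvx.symm,
      h2.trans (le_add_single C v x), ?_⟩
    have := hK.one_le hv
    simp; omega

lemma one_sub_le_solvableProb_cliqueSquare {B : ℕ} (hn : 6 + 2 * B ≤ n) {t : ℕ}
    (ht : (6 + 2 * B) * n ≤ t) :
    1 - (2 * Real.exp (-1 / 12) ^ B + (4 * (7 / 9 : ℝ) ^ 6) ^ n) ≤
      solvableProb (cliqueSquare n) t := by
  have hn6 : 6 ≤ n := by omega
  have : Nonempty (Fin n) := ⟨⟨0, by omega⟩⟩
  have hpos : (0 : ℝ) < n := by exact_mod_cast (by omega : 0 < n)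
  have hnB : (6 : ℝ) + 2 * B ≤ n := by exact_mod_cast hn
  have hB : (0 : ℝ) ≤ B := Nat.cast_nonneg B
  have hq1 : 1 / (12 * (n : ℝ)) ≤ 1 := by
    rw [div_le_one (by positivity)]; linarith
  have hexp : (1 - 1 / (12 * (n : ℝ))) ^ (B * n) ≤ Real.exp (-1 / 12) ^ B := by
    have h1 : 1 - 1 / (12 * (n : ℝ)) ≤ Real.exp (-(1 / (12 * n))) := Real.one_sub_le_exp_neg _
    refine (pow_le_pow_left₀ (by linarith) h1 _).trans_eq ?_
    rw [← Real.exp_nat_mul, ← Real.exp_nat_mul]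
    congr 1
    push_cast
    field_simp
  have h0 : prob (V := Fin n × Fin n) (6 * n) (fun C => ¬ HasGiant C) ≤
      (4 * (7 / 9 : ℝ) ^ 6) ^ n :=
    (prob_mono fun C _ hC h => hC h.exists_linkedSet).trans (prob_not_cutsOccupied_le hn6)
  -- Since `(6 + 2B) n ≤ n ^ 2`, the urn weight stays below `2 n ^ 2`; hitting one of `n / 6` cells
  -- thus has probability at least `1 / (12n)`.
  have h1 := prob_not_add_le (V := Fin n × Fin n) (q := 1 / (12 * (n : ℝ))) HasGiant.add_single
    HasGiantOne.add_single (by positivity) hq1 (fun C h _ => h.exists_hasGiantOne)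
    (6 * n) (B * n) (by
      simp only [Fintype.card_prod, Fintype.card_fin]
      push_cast
      rw [div_mul_eq_mul_div, div_le_div_iff₀ (by positivity) (by norm_num)]
      nlinarith)
  have h2 := prob_not_add_le (V := Fin n × Fin n) (q := 1 / (12 * (n : ℝ)))
    HasGiantOne.add_single
    HasTwo.add_single (by positivity) hq1 (fun C h _ => h.exists_hasTwo hn6)
    (6 * n + B * n) (B * n) (by
      simp only [Fintype.card_prod, Fintype.card_fin]
      push_cast
      rw [div_mul_eq_mul_div, div_le_div_iff₀ (by positivity) (by norm_num)]
      nlinarith)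
  have h3 : prob t (fun C => ¬ Solvable (cliqueSquare n) C) ≤
      prob (6 * n + B * n + B * n) (fun C => ¬ HasTwo C) :=
    (prob_mono fun C _ hC h => hC h.solvable).trans
      (prob_not_antitone HasTwo.add_single (by linarith))
  rw [prob_not, ← solvableProb_eq_prob] at h3
  linarith

/-- `C n` pebbles suffice on the square of `K_n`, for a large constant `C`. -/
theorem eventually_le_solvableProb_cliqueSquare {ε : ℝ} (hε : 0 < ε) :
    ∃ A : ℝ, 0 < A ∧ ∀ᶠ n : ℕ in atTop, ∀ t : ℕ, A * n ≤ t →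
      1 - ε ≤ solvableProb (cliqueSquare n) t := by
  obtain ⟨B, hB⟩ := exists_pow_lt_of_lt_one (show 0 < ε / 3 by positivity)
    (show Real.exp (-1 / 12) < 1 by rw [Real.exp_lt_one_iff]; norm_num)
  refine ⟨6 + 2 * B, by positivity, ?_⟩
  have hlim := tendsto_pow_atTop_nhds_zero_of_lt_one (r := 4 * (7 / 9 : ℝ) ^ 6)
    (by norm_num) (by norm_num)
  filter_upwards [eventually_ge_atTop (6 + 2 * B),
    hlim.eventually_lt_const (show 0 < ε / 3 by positivity)] with n hn hr t ht
  have := one_sub_le_solvableProb_cliqueSquare hn (t := t) (by exact_mod_cast ht)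
  linarith

end Giant

/-! ### From probability bounds to membership in the threshold -/

section Threshold

variable {V : ℕ → Type*} [∀ n, Fintype (V n)] [∀ n, DecidableEq (V n)]

/-- Far fewer than `√|V|` pebbles almost never suffice, on any graphs. -/
theorem eventually_solvableProb_le (G : ∀ n, SimpleGraph (V n))
    (hV : Tendsto (fun n => Fintype.card (V n)) atTop atTop) {ε : ℝ} (hε : 0 < ε) :
    ∃ δ : ℝ, 0 < δ ∧ ∀ᶠ n in atTop, ∀ t : ℕ, t ≤ δ * √(Fintype.card (V n) : ℝ) →
      solvableProb (G n) t ≤ ε := by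
  refine ⟨min ε (1 / 2), by positivity, ?_⟩
  filter_upwards [hV.eventually_ge_atTop 1] with n hn t ht
  have : Nonempty (V n) := Fintype.card_pos_iff.1 hn
  have hN : (1 : ℝ) ≤ Fintype.card (V n) := by exact_mod_cast hn
  have hsq : √(Fintype.card (V n) : ℝ) ^ 2 = Fintype.card (V n) := Real.sq_sqrt (by positivity)
  have hs : 1 ≤ √(Fintype.card (V n) : ℝ) := Real.one_le_sqrt.2 hN
  have h1 : min ε (1 / 2) ≤ ε := min_le_left _ _
  have h2 : min ε (1 / 2) ≤ 1 / 2 := min_le_right _ _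
  have h0 : 0 < min ε (1 / 2) := by positivity
  generalize min ε (1 / 2) = δ at *
  have ht0 : (0 : ℝ) ≤ t := Nat.cast_nonneg t
  refine (solvableProb_le (G n) ?_).trans ?_
  · have : (t : ℝ) < Fintype.card (V n) := by nlinarith
    exact_mod_cast this
  · rw [div_le_iff₀ (by linarith), ← hsq]
    calc (t : ℝ) ^ 2 ≤ (δ * √(Fintype.card (V n) : ℝ)) ^ 2 := pow_le_pow_left₀ ht0 ht 2
      _ = δ ^ 2 * √(Fintype.card (V n) : ℝ) ^ 2 := by ring
      _ ≤ ε * √(Fintype.card (V n) : ℝ) ^ 2 :=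
        mul_le_mul_of_nonneg_right (by nlinarith) (by positivity)

variable {G : ∀ n, SimpleGraph (V n)} {s : ℕ → ℝ}

lemma exists_strictMono_of_not_isBigO {f g : ℕ → ℝ} (h : ¬ f =O[atTop] g) :
    ∃ φ : ℕ → ℕ, StrictMono φ ∧ ∀ k : ℕ, ((k : ℝ) + 1) * ‖g (φ k)‖ < ‖f (φ k)‖ := by
  refine extraction_forall_of_frequently
    (P := fun k n : ℕ => ((k : ℝ) + 1) * ‖g n‖ < ‖f n‖) fun k => ?_
  rw [isBigO_iff] at h
  push Not at h
  exact h (k + 1)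

/-- Otherwise `f` is negligible against `s` along a subsequence. Taking about `δ s` pebbles there
gives `t ≫ f` while solvability has probability at most `1 / 2`. -/
lemma isBigO_of_mem_threshold (hs : Tendsto s atTop atTop)
    (hlow : ∃ δ : ℝ, 0 < δ ∧ ∀ᶠ n in atTop, ∀ t : ℕ, t ≤ δ * s n →
      solvableProb (G n) t ≤ 1 / 2)
    {f : ℕ → ℝ} (hf : f ∈ threshold G) : s =O[atTop] f := by
  classical
  by_contra hO
  obtain ⟨φ, hφ, hlt⟩ := exists_strictMono_of_not_isBigO hO
  obtain ⟨δ, hδ, hlow⟩ := hlow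
  -- Off the subsequence the value only serves to keep `f = o(t)` along all `n`.
  let t : ℕ → ℕ := fun n => if n ∈ Set.range φ then ⌊δ * s n⌋₊ else ⌈n * ‖f n‖⌉₊
  have ht : f =o[atTop] fun n => (t n : ℝ) := by
    rw [isLittleO_iff]
    intro c hc
    filter_upwards [hs.eventually_ge_atTop (2 / δ), eventually_ge_atTop (φ ⌈2 / (δ * c)⌉₊),
      eventually_ge_atTop ⌈1 / c⌉₊] with n hsn hn hn'
    have hn' : 1 / c ≤ n := (Nat.le_ceil _).trans (by exact_mod_cast hn')
    rw [Real.norm_natCast]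
    by_cases hr : n ∈ Set.range φ
    · simp only [t, hr, if_true]
      obtain ⟨k, rfl⟩ := hr
      have hk : 2 / (δ * c) ≤ k :=
        (Nat.le_ceil _).trans (by exact_mod_cast hφ.le_iff_le.1 hn)
      have h1 := hlt k
      have hs0 : 0 < s (φ k) := lt_of_lt_of_le (by positivity) hsn
      rw [Real.norm_of_nonneg hs0.le] at h1
      have h2 := Nat.lt_floor_add_one (δ * s (φ k))
      rw [div_le_iff₀ hδ] at hsn
      rw [div_le_iff₀ (by positivity)] at hk
      have h3 : δ * s (φ k) / 2 ≤ ⌊δ * s (φ k)⌋₊ := by linarith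
      have h4 : 2 * ‖f (φ k)‖ ≤ δ * c * s (φ k) := by
        have h5 : 2 * ‖f (φ k)‖ ≤ k * (δ * c) * ‖f (φ k)‖ :=
          mul_le_mul_of_nonneg_right hk (norm_nonneg _)
        have h6 : δ * c * (k * ‖f (φ k)‖) ≤ δ * c * s (φ k) :=
          mul_le_mul_of_nonneg_left (by linarith [norm_nonneg (f (φ k))]) (by positivity)
        linarith
      have h7 := mul_le_mul_of_nonneg_left h3 hc.le
      linarith
    · simp only [t, hr, if_false]
      have h1 := Nat.le_ceil ((n : ℝ) * ‖f n‖)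
      rw [div_le_iff₀ hc] at hn'
      have h2 := mul_le_mul_of_nonneg_right hn' (norm_nonneg (f n))
      have h3 := mul_le_mul_of_nonneg_left h1 hc.le
      linarith
  have hlim := (hf.1 t ht).comp hφ.tendsto_atTop
  obtain ⟨k, h1, h2, h3⟩ := ((hlim.eventually_const_lt (show (1 / 2 : ℝ) < 1 by norm_num)).and
    ((hφ.tendsto_atTop.eventually hlow).and
      (hφ.tendsto_atTop.eventually (hs.eventually_ge_atTop 0)))).exists
  refine absurd h1 (not_lt.2 (h2 (t (φ k)) ?_))
  simp only [t, Set.mem_range_self, if_true]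
  exact Nat.floor_le (mul_nonneg hδ.le h3)

lemma isBigO_of_mem_threshold' (hs : Tendsto s atTop atTop)
    (hup : ∃ A : ℝ, 0 < A ∧ ∀ᶠ n in atTop, ∀ t : ℕ, A * s n ≤ t →
      1 / 2 ≤ solvableProb (G n) t)
    {f : ℕ → ℝ} (hf : f ∈ threshold G) : f =O[atTop] s := by
  classical
  by_contra hO
  obtain ⟨φ, hφ, hlt⟩ := exists_strictMono_of_not_isBigO hO
  obtain ⟨A, hA, hup⟩ := hup
  -- Here `0` off the subsequence makes `t = o(f)` trivial there.
  let t : ℕ → ℕ := fun n => if n ∈ Set.range φ then ⌈A * s n⌉₊ else 0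
  have ht : (fun n => (t n : ℝ)) =o[atTop] f := by
    rw [isLittleO_iff]
    intro c hc
    filter_upwards [hs.eventually_ge_atTop 1, eventually_ge_atTop (φ ⌈(A + 1) / c⌉₊)] with n hsn hn
    rw [Real.norm_natCast]
    by_cases hr : n ∈ Set.range φ
    · simp only [t, hr, if_true]
      obtain ⟨k, rfl⟩ := hr
      have hk : (A + 1) / c ≤ k :=
        (Nat.le_ceil _).trans (by exact_mod_cast hφ.le_iff_le.1 hn)
      have h1 := hlt k
      have hs0 : 0 < s (φ k) := by linarith
      rw [Real.norm_of_nonneg hs0.le] at h1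
      have h2 := Nat.ceil_lt_add_one (mul_nonneg hA.le hs0.le)
      rw [div_le_iff₀ hc] at hk
      have h3 := mul_le_mul_of_nonneg_right hk hs0.le
      have h4 : c * ((k + 1) * s (φ k)) ≤ c * ‖f (φ k)‖ := mul_le_mul_of_nonneg_left h1.le hc.le
      have h5 : 0 ≤ c * s (φ k) := by positivity
      linarith
    · simp only [t, hr, if_false, Nat.cast_zero]
      positivity
  have hlim := (hf.2 t ht).comp hφ.tendsto_atTop
  obtain ⟨k, h1, h2⟩ := ((hlim.eventually_lt_const (show (0 : ℝ) < 1 / 2 by norm_num)).and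
    (hφ.tendsto_atTop.eventually hup)).exists
  refine absurd h1 (not_lt.2 (h2 (t (φ k)) ?_))
  simp only [t, Set.mem_range_self, if_true]
  exact Nat.le_ceil _

lemma solvableProb_le_one {W : Type*} [Fintype W] [DecidableEq W] (H : SimpleGraph W) (t : ℕ) :
    solvableProb H t ≤ 1 := by
  classical
  exact div_le_one_of_le₀ (by exact_mod_cast Finset.card_filter_le _ _) (Nat.cast_nonneg _)

lemma mem_threshold_of_isTheta (hs : Tendsto s atTop atTop)
    (hlow : ∀ ε : ℝ, 0 < ε → ∃ δ : ℝ, 0 < δ ∧ ∀ᶠ n in atTop, ∀ t : ℕ, t ≤ δ * s n →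
      solvableProb (G n) t ≤ ε)
    (hup : ∀ ε : ℝ, 0 < ε → ∃ A : ℝ, 0 < A ∧ ∀ᶠ n in atTop, ∀ t : ℕ, A * s n ≤ t →
      1 - ε ≤ solvableProb (G n) t)
    {f : ℕ → ℝ} (hf : f =Θ[atTop] s) : f ∈ threshold G := by
  refine ⟨fun t ht => ?_, fun t ht => ?_⟩
  · have ht := hf.2.trans_isLittleO ht
    refine tendsto_order.2 ⟨fun a ha => ?_, fun a ha =>
      .of_forall fun n => (solvableProb_le_one _ _).trans_lt ha⟩
    obtain ⟨A, hA, h⟩ := hup ((1 - a) / 2) (by linarith)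
    filter_upwards [h, isLittleO_iff.1 ht (inv_pos.2 hA), hs.eventually_ge_atTop 0]
      with n h1 h2 h3
    rw [Real.norm_natCast, Real.norm_of_nonneg h3, ← div_eq_inv_mul, le_div_iff₀ hA] at h2
    linarith [h1 (t n) (by linarith)]
  · have ht := ht.trans_isBigO hf.1
    refine tendsto_order.2 ⟨fun a ha =>
      .of_forall fun n => ha.trans_le (div_nonneg (Nat.cast_nonneg _) (Nat.cast_nonneg _)),
      fun a ha => ?_⟩
    obtain ⟨δ, hδ, h⟩ := hlow (a / 2) (by linarith)
    filter_upwards [h, isLittleO_iff.1 ht hδ, hs.eventually_ge_atTop 0] with n h1 h2 h3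
    rw [Real.norm_natCast, Real.norm_of_nonneg h3] at h2
    linarith [h1 (t n) h2]

end Threshold

/-! ### The threshold of the squares and the product inequality -/

lemma sqrt_card_fin_prod (n : ℕ) : √(Fintype.card (Fin n × Fin n) : ℝ) = n := by
  simp

theorem threshold_cliqueSquare :
    threshold cliqueSquare =
      {f : ℕ → ℝ | f =Θ[atTop] (fun n : ℕ => √(Fintype.card (Fin n × Fin n) : ℝ))} := by
  have hs : Tendsto (fun n : ℕ => √(Fintype.card (Fin n × Fin n) : ℝ)) atTop atTop := by
    simpa only [sqrt_card_fin_prod] using tendsto_natCast_atTop_atTop (R := ℝ)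
  have hV : Tendsto (fun n => Fintype.card (Fin n × Fin n)) atTop atTop := by
    simpa using tendsto_id.atTop_mul_atTop₀ tendsto_id
  have hlow : ∀ ε : ℝ, 0 < ε → _ := fun ε hε => eventually_solvableProb_le cliqueSquare hV hε
  have hup : ∀ ε : ℝ, 0 < ε → ∃ A : ℝ, 0 < A ∧ ∀ᶠ n : ℕ in atTop, ∀ t : ℕ,
      A * √(Fintype.card (Fin n × Fin n) : ℝ) ≤ t → 1 - ε ≤ solvableProb (cliqueSquare n) t := by
    simp only [sqrt_card_fin_prod]
    exact fun ε hε => eventually_le_solvableProb_cliqueSquare hε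
  ext f
  refine ⟨fun hf => ⟨isBigO_of_mem_threshold' hs ?_ hf,
    isBigO_of_mem_threshold hs (hlow _ (by norm_num)) hf⟩,
    mem_threshold_of_isTheta hs hlow hup⟩
  have := hup (1 / 2) (by norm_num)
  norm_num only at this ⊢
  exact this

theorem sqrt_isBigO_of_mem_threshold_clique {f : ℕ → ℝ} (hf : f ∈ threshold clique) :
    (fun n : ℕ => √(n : ℝ)) =O[atTop] f := by
  have hlow := eventually_solvableProb_le clique (by simp only [Fintype.card_fin]; exact tendsto_id)
    (show (0 : ℝ) < 1 / 2 by norm_num)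
  simp only [Fintype.card_fin] at hlow
  exact isBigO_of_mem_threshold (Real.tendsto_sqrt_atTop.comp tendsto_natCast_atTop_atTop) hlow hf

end Pebbling

theorem theorem1 :
    (Pebbling.threshold Pebbling.cliqueSquare =
      {f : ℕ → ℝ | f =Θ[atTop] (fun n : ℕ => Real.sqrt (Fintype.card (Fin n × Fin n) : ℝ))}) ∧
    (∀ f g h : ℕ → ℝ, f ∈ Pebbling.threshold Pebbling.clique →
      g ∈ Pebbling.threshold Pebbling.clique → h ∈ Pebbling.threshold Pebbling.cliqueSquare →
      h =O[atTop] (fun n => f n * g n)) := by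
  refine ⟨Pebbling.threshold_cliqueSquare, fun f g h hf hg hh => ?_⟩
  rw [Pebbling.threshold_cliqueSquare] at hh
  refine hh.1.trans ?_
  simpa only [Pebbling.sqrt_card_fin_prod, Real.mul_self_sqrt (Nat.cast_nonneg _)] using
    (Pebbling.sqrt_isBigO_of_mem_threshold_clique hf).mul
      (Pebbling.sqrt_isBigO_of_mem_threshold_clique hg)
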